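/- All logarithms $\log$ are to base 2, $\log^* n$ is the number of times $\log$ must be applied to $n$ to reach a value at most $1$, and $\alpha=\alpha(G)$ is the arboricity of $G$, the least number of forests into which $E(G)$ can be partitioned. In the LOCAL model, every vertex of the input graph hosts a processor, which initially knows its own identifier, the identifiers of its neighbours, the global parameters, and a private random seed, independent of the other seeds. The identifiers are distinct integers in $\{0,\dots,n^q-1\}$ for a constant $q$. Computation proceeds in synchronous rounds, in each of which a processor may send a message of arbitrary length to each neighbour, and local computation is unbounded. The number of rounds of an execution is the number of rounds until all processors have halted with an output. **Theorem.** For all constants $K$, $D$, $c\ge 1$, $q,d\in\mathbb N$ there are a constant $C>0$ and a randomized LOCAL algorithm that is given $n\ge 2$, a real number $a$ and a real number $t$, such that the following holds for every $n$-vertex graph $G$ with at least one edge and every $a$ with $a\le c\,\alpha$ and $\alpha\le c\,a$ (an estimate of the arboricity up to a constant factor). (i) If $2<t\le K\sqrt{n/\log n}$, then the algorithm always produces a proper colouring of $G$ with at most $C\,t\,\alpha\log n$ colours, and its number of rounds is at most $C(\log_t n+\log^* n)$, both in expectation and with probability at least $1-n^{-d}$. (ii) If $k>0$ is a real number with $2<n^{1/k}\le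 K\sqrt{n/\log n}$, then the algorithm with $t=n^{1/k}$ always produces a proper colouring of $G$ with at most $C\,\alpha\, n^{1/k}\log n$ colours, and its number of rounds is at most $C(k+\log^* n)$, both in expectation and with probability at least $1-n^{-d}$. If moreover $\log^* n\le D\,k$ (which covers the regime $k=\omega(\sqrt{\log n})$), then its number of rounds is at most $C\,k$, both in expectation and with probability at least $1-n^{-d}$. -/

import Mathlib

open scoped ENNReal

noncomputable section

/-- The arboricity of a graph: the least `r` such that the edge set can be partitioned
into `r` forests. -/
def SimpleGraph.arboricity {V : Type*} (G : SimpleGraph V) : ℕ :=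
  sInf {r : ℕ | ∃ F : Fin r → SimpleGraph V,
    (∀ i, (F i).IsAcyclic) ∧
    (∀ i j, i ≠ j → Disjoint (F i).edgeSet (F j).edgeSet) ∧
    (⋃ i, (F i).edgeSet) = G.edgeSet}

/-- The iterated logarithm: the least `i` such that applying `log₂` to `n` exactly `i` times
gives a value that is at most `1`. -/
def logStar (n : ℕ) : ℕ :=
  sInf {i : ℕ | (Real.logb 2)^[i] (n : ℝ) ≤ 1}

/-- A randomized algorithm in the LOCAL model that outputs natural numbers (colours).
All nodes run the same code. Local computation and message length are unbounded.
Global parameters known to all nodes are arguments of a family of such algorithms.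

* At the start, a node knows its own identifier, the set of the identifiers of its neighbours,
  and a private random seed, uniformly distributed in the finite type `Seed`, independent of
  the seeds of the other nodes.
* In each round, a node in state `s` sends the message `send s i` to its neighbour with
  identifier `i`; it then receives the set of all pairs (identifier of the sender, message)
  sent to it, and updates its state by `recv`.
* A node halts, with output `c`, as soon as its state `s` satisfies `output s = some c`. -/
structure LocalAlgorithm where
  Seed : Type
  State : Type
  Msg : Type
  [seedFintype : Fintype Seed]
  [seedNonempty : Nonempty Seed]
  init : (ident : ℕ) → (neighbours : Set ℕ) → Seed → State
  send : State → ℕ → Msg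
  recv : State → Set (ℕ × Msg) → State
  output : State → Option ℕ

namespace LocalAlgorithm

attribute [instance] LocalAlgorithm.seedFintype LocalAlgorithm.seedNonempty

variable {V : Type} (A : LocalAlgorithm) (G : SimpleGraph V) (ident : V → ℕ)

/-- The messages that node `v` receives in a round that starts in the configuration `σ`,
each with the identifier of its sender. Halted nodes are silent. -/
def inbox (σ : V → A.State) (v : V) : Set (ℕ × A.Msg) :=
  {x | ∃ u, G.Adj v u ∧ A.output (σ u) = none ∧ x = (ident u, A.send (σ u) (ident v))}

/-- One synchronous round. Halted nodes keep their state, so that outputs are irrevocable. -/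
def step (σ : V → A.State) (v : V) : A.State :=
  match A.output (σ v) with
  | some _ => σ v
  | none => A.recv (σ v) (A.inbox G ident σ v)

/-- The configuration after `r` rounds, when node `v` has the random seed `ρ v`. -/
def config (ρ : V → A.Seed) (r : ℕ) : V → A.State :=
  (A.step G ident)^[r] (fun v => A.init (ident v) (ident '' G.neighborSet v) (ρ v))

/-- The number of rounds of the execution with random seeds `ρ`: the first round after which
all nodes have halted, and `∞` if there is none. -/
def rounds (ρ : V → A.Seed) : ℝ≥0∞ :=
  ⨅ (r : ℕ) (_ : ∀ v, A.output (A.config G ident ρ r v) ≠ none), (r : ℝ≥0∞)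

/-- In the execution with random seeds `ρ` all nodes eventually halt, and their outputs are a
proper colouring of `G` with the palette `{0, …, p - 1}`. -/
def ProducesColoring (ρ : V → A.Seed) (p : ℕ) : Prop :=
  ∃ (r : ℕ) (f : G.Coloring (Fin p)),
    ∀ v, A.output (A.config G ident ρ r v) = some (f v : ℕ)

/-- The expected number of rounds: the average over all assignments of seeds to the nodes. -/
def expectedRounds [Fintype V] [DecidableEq V] : ℝ≥0∞ :=
  (∑ ρ : V → A.Seed, A.rounds G ident ρ) / (Fintype.card (V → A.Seed) : ℝ≥0∞)

/-- The probability of an event, over independent uniformly distributed seeds of the nodes. -/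
def prob (E : Set (V → A.Seed)) : ℝ :=
  (E.ncard : ℝ) / (Nat.card (V → A.Seed) : ℝ)

/-- On the graph `G` with the given identifiers, the algorithm always produces a proper
`p`-colouring; the number of rounds is at most `T` in expectation, and it is at most `T`
with probability at least `1 - δ`. -/
def Colors [Fintype V] [DecidableEq V] (p : ℕ) (T δ : ℝ) : Prop :=
  (∀ ρ : V → A.Seed, A.ProducesColoring G ident ρ p) ∧
  A.expectedRounds G ident ≤ ENNReal.ofReal T ∧
  1 - δ ≤ A.prob {ρ : V → A.Seed | A.rounds G ident ρ ≤ ENNReal.ofReal T}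

end LocalAlgorithm

end

/-! ### Forests, arboricity and the average degree of induced subgraphs -/

namespace SimpleGraph

/-! Peeling splits the graph into layers of small degree, and random trials with a palette much
larger than that degree colour each layer. Put `x = log_t n`. Induced subgraphs have average degree
at most `2α` (`SimpleGraph.sum_card_adj_le`), so at most a fraction `1/√t` of their vertices has
degree above `D = ⌊2ca√t⌋`. Deleting all other vertices, round after round, therefore exhausts the
graph within `⌊2x⌋ + 1` rounds (`peelRun_level_lt`), and a vertex has at most `D` neighbours in its
own layer, its peers (`ncard_peelPeers_le`).

Layers get disjoint palettes of `p + 1 > 2cat` colours, so only peers compete. In one trial the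
peers block at most `D` colours, whatever happened before. A trial thus fails with probability at
most `D/(p+1) ≤ 1/√t`, and all of `M ≥ 2(d+2)x` trials fail with probability at most `n^{-(d+2)}`
(`card_all_trials_bad_le`). By a union bound, some vertex remains uncoloured with probability at
most `n^{-(d+1)}`.

The remaining vertices are coloured greedily. The uncoloured vertex with the smallest identifier
wins every tie, so two rounds always colour a vertex (`exists_colour_fixed`). Hence the algorithm
stops on every seed, at most `2n` rounds late, which adds only a constant to the expectation.
Properness holds on every seed (`peelRun_colour_ne`). The layers and palettes give `O(tα log n)`
colours; the additive constant in the round bound is absorbed by `log* n ≥ 1`. For `t = n^{1/k}`,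
`log_t n = k`. -/

lemma IsAcyclic.card_edgeFinset_le {V : Type*} [Fintype V] {F : SimpleGraph V}
    [Fintype F.edgeSet] (hF : F.IsAcyclic) : F.edgeFinset.card ≤ Fintype.card V := by
  classical
  rcases isEmpty_or_nonempty V with h | h
  · have : F.edgeFinset = ∅ := by
      rw [edgeFinset_eq_empty]
      ext u
      exact h.elim u
    simp [this]
  · obtain ⟨T, hFT, -, hT⟩ :=
      (connected_top (V := V)).exists_isTree_le_of_le_of_isAcyclic le_top hF
    have h1 := hT.card_edgeFinset
    have h2 := Finset.card_le_card (edgeFinset_mono hFT)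
    lia

lemma isAcyclic_fromEdgeSet_singleton {V : Type*} (e : Sym2 V) :
    (fromEdgeSet {e}).IsAcyclic := by
  intro v w hw
  have h1 : ∀ x ∈ w.edges, x = e := by
    intro x hx
    have := w.edges_subset_edgeSet hx
    simp at this
    exact this.1
  have h2 := hw.edges_nodup
  have h3 := hw.three_le_length
  rw [← Walk.length_edges] at h3
  have h4 : w.edges.length ≤ [e].length :=
    (h2.subperm (fun x hx => by simp [h1 x hx])).length_le
  simp only [List.length_singleton] at h4
  lia

/-- The infimum is attained because the set is nonempty: every edge may form a forest of its own. -/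
lemma arboricity_spec {V : Type*} [Finite V] (G : SimpleGraph V) :
    ∃ F : Fin G.arboricity → SimpleGraph V,
      (∀ i, (F i).IsAcyclic) ∧
      (∀ i j, i ≠ j → Disjoint (F i).edgeSet (F j).edgeSet) ∧
      (⋃ i, (F i).edgeSet) = G.edgeSet := by
  apply Nat.sInf_mem (s := {r : ℕ | ∃ F : Fin r → SimpleGraph V,
    (∀ i, (F i).IsAcyclic) ∧
    (∀ i j, i ≠ j → Disjoint (F i).edgeSet (F j).edgeSet) ∧
    (⋃ i, (F i).edgeSet) = G.edgeSet})
  obtain ⟨r, ⟨φ⟩⟩ := Finite.exists_equiv_fin G.edgeSet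
  have key : ∀ i, (fromEdgeSet {(φ.symm i : Sym2 V)}).edgeSet = {(φ.symm i : Sym2 V)} := by
    intro i
    rw [edgeSet_fromEdgeSet, sdiff_eq_left, Set.disjoint_singleton_left]
    exact G.not_isDiag_of_mem_edgeSet (φ.symm i).2
  refine ⟨r, fun i => fromEdgeSet {(φ.symm i : Sym2 V)},
    fun i => isAcyclic_fromEdgeSet_singleton _, fun i j hij => ?_, ?_⟩
  · rw [key, key, Set.disjoint_singleton]
    exact fun h => hij (φ.symm.injective (Subtype.ext h))
  · ext e
    simp only [key, Set.mem_iUnion, Set.mem_singleton_iff]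
    constructor
    · rintro ⟨i, rfl⟩
      exact (φ.symm i).2
    · intro he
      exact ⟨φ ⟨e, he⟩, by simp⟩

lemma one_le_arboricity {V : Type*} [Finite V] {G : SimpleGraph V} (hG : G ≠ ⊥) :
    1 ≤ G.arboricity := by
  by_contra! h
  obtain ⟨F, -, -, hF⟩ := G.arboricity_spec
  have : IsEmpty (Fin G.arboricity) := by
    rw [Nat.lt_one_iff.1 h]
    infer_instance
  rw [Set.iUnion_of_empty] at hF
  exact hG (edgeSet_eq_empty.1 hF.symm)

/-- The average degree of an induced subgraph is at most twice the arboricity. -/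
lemma sum_card_adj_le {V : Type*} [Finite V] (G : SimpleGraph V) (S : Finset V) :
    ∑ v ∈ S, {u | G.Adj v u ∧ u ∈ S}.ncard ≤ 2 * G.arboricity * S.card := by
  classical
  have := Fintype.ofFinite V
  obtain ⟨F, hF, -, hG⟩ := G.arboricity_spec
  have forest : ∀ i, ∑ v ∈ S, {u | (F i).Adj v u ∧ u ∈ S}.ncard ≤ 2 * S.card := by
    intro i
    have h1 := ((hF i).induce (S : Set V)).card_edgeFinset_le
    have h2 := ((F i).induce (S : Set V)).sum_degrees_eq_twice_card_edges
    have h3 : ∑ v ∈ S, {u | (F i).Adj v u ∧ u ∈ S}.ncard =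
        ∑ v : (S : Set V), ((F i).induce (S : Set V)).degree v := by
      rw [← Finset.sum_coe_sort]
      refine Finset.sum_congr rfl fun v _ => ?_
      rw [← card_neighborFinset_eq_degree, ← Set.ncard_coe_finset,
        ← Set.ncard_image_of_injective _ (Subtype.val_injective (p := fun x => x ∈ (S : Set V)))]
      congr 1
      ext u
      simp [and_comm]
    rw [h3, h2]
    simp only [Finset.coe_sort_coe, Fintype.card_coe] at h1
    refine Nat.mul_le_mul_left 2 (le_trans (le_of_eq ?_) h1)
    congr!
  calc ∑ v ∈ S, {u | G.Adj v u ∧ u ∈ S}.ncard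
      ≤ ∑ v ∈ S, ∑ i, {u | (F i).Adj v u ∧ u ∈ S}.ncard := by
        refine Finset.sum_le_sum fun v _ => ?_
        -- Only the covering of the edges by the forests matters for the upper bound, not its
        -- disjointness.
        have : {u | G.Adj v u ∧ u ∈ S} ⊆ ⋃ i, {u | (F i).Adj v u ∧ u ∈ S} := by
          rintro u ⟨hu, huS⟩
          rw [← mem_edgeSet, ← hG, Set.mem_iUnion] at hu
          obtain ⟨i, hi⟩ := hu
          exact Set.mem_iUnion.2 ⟨i, hi, huS⟩
        refine (Set.ncard_le_ncard this (Set.toFinite _)).trans ?_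
        exact Set.ncard_iUnion_le_of_fintype _
    _ = ∑ i, ∑ v ∈ S, {u | (F i).Adj v u ∧ u ∈ S}.ncard := Finset.sum_comm
    _ ≤ ∑ i : Fin G.arboricity, 2 * S.card := Finset.sum_le_sum fun i _ => forest i
    _ = 2 * G.arboricity * S.card := by simp; ring

end SimpleGraph

/-! ### Independent trials, by counting seeds -/

/-- Updating the seed of node `v` in position `r` only. -/
def updateSeed {V : Type*} [DecidableEq V] {M : ℕ} {β : Type*} (ρ : V → Fin M → β) (v : V)
    (r : Fin M) (y : β) : V → Fin M → β :=
  Function.update ρ v (Function.update (ρ v) r y)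

section Counting

variable {V : Type*} [DecidableEq V] {M : ℕ} {β : Type*}

lemma updateSeed_apply_self (ρ : V → Fin M → β) (v : V) (r : Fin M) (y : β) :
    updateSeed ρ v r y v r = y := by
  simp [updateSeed]

lemma updateSeed_apply_ne (ρ : V → Fin M → β) (v : V) (r : Fin M) (y : β) {u : V} {s : Fin M}
    (h : u ≠ v ∨ s ≠ r) : updateSeed ρ v r y u s = ρ u s := by
  rcases eq_or_ne u v with rfl | hu
  · have : s ≠ r := by simpa using h
    simp [updateSeed, this]
  · simp [updateSeed, hu]

lemma updateSeed_updateSeed_self (ρ : V → Fin M → β) (v : V) (r : Fin M) (y : β) :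
    updateSeed (updateSeed ρ v r y) v r (ρ v r) = ρ := by
  simp [updateSeed]

/-- If in each of `M` trials a uniform choice among `|β|` values is bad for at most `D` values,
which are determined by the earlier trials, then all trials are bad with probability at most
`(D / |β|) ^ M`. -/
lemma card_all_trials_bad_le [Fintype V] [Fintype β] [DecidableEq β] (v : V) (D : ℕ)
    (B : Fin M → (V → Fin M → β) → Finset β) (hB : ∀ r ρ, (B r ρ).card ≤ D)
    (hdep : ∀ r s ρ y, s ≤ r → B s (updateSeed ρ v r y) = B s ρ) :
    (Finset.univ.filter fun ρ : V → Fin M → β => ∀ r, ρ v r ∈ B r ρ).card * Fintype.card β ^ M ≤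
      D ^ M * Fintype.card (V → Fin M → β) := by
  have main : ∀ m, m ≤ M →
      (Finset.univ.filter fun ρ : V → Fin M → β => ∀ r : Fin M, r < m → ρ v r ∈ B r ρ).card *
        Fintype.card β ^ m ≤ D ^ m * Fintype.card (V → Fin M → β) := by
    intro m
    induction m with
    | zero => simp
    | succ m ih =>
      intro hm
      set E := fun k : ℕ => Finset.univ.filter
        fun ρ : V → Fin M → β => ∀ r : Fin M, r < k → ρ v r ∈ B r ρ with hE
      have key : (E (m + 1)).card * Fintype.card β ≤ D * (E m).card := by
        let r : Fin M := ⟨m, hm⟩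
        rw [← Finset.card_univ, ← Finset.card_product]
        have h1 : ((E (m + 1)) ×ˢ (Finset.univ : Finset β)).card ≤
            ((E m).sigma fun ρ => B r ρ).card := by
          -- Swap the draw `ρ v r` with the spare value `y`. The old draw is bad and the bad set
          -- does not see the swap, so it lands in the fibre; swapping back gives injectivity.
          refine Finset.card_le_card_of_injOn
            (fun x => (⟨updateSeed x.1 v r x.2, x.1 v r⟩ : Sigma fun _ => β)) ?_ ?_
          · rintro ⟨ρ, y⟩ hx
            simp only [Finset.coe_product, Set.mem_prod, Finset.mem_coe, hE, Finset.mem_filter,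
              Finset.mem_univ, true_and, and_true] at hx
            simp only [Finset.coe_sigma, Set.mem_sigma_iff, Finset.mem_coe, hE,
              Finset.mem_filter, Finset.mem_univ, true_and]
            refine ⟨fun s hs => ?_, ?_⟩
            · rw [hdep r s ρ y hs.le, updateSeed_apply_ne _ _ _ _ (Or.inr (Fin.ne_of_lt hs))]
              exact hx s (by lia)
            · rw [hdep r r ρ y le_rfl]
              exact hx r (by simp [r])
          · rintro ⟨ρ, y⟩ - ⟨ρ', y'⟩ - h
            simp only [Sigma.mk.injEq, heq_eq_eq] at h
            obtain ⟨h1, h2⟩ := h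
            have hy : y = y' := by
              rw [← updateSeed_apply_self ρ v r y, h1, updateSeed_apply_self]
            have hρ : ρ = ρ' := by
              rw [← updateSeed_updateSeed_self ρ v r y, h1, h2, updateSeed_updateSeed_self]
            rw [hy, hρ]
        refine h1.trans ?_
        rw [Finset.card_sigma, mul_comm]
        exact Finset.sum_le_card_nsmul _ _ _ fun ρ _ => hB r ρ
      calc (E (m + 1)).card * Fintype.card β ^ (m + 1)
          = (E (m + 1)).card * Fintype.card β * Fintype.card β ^ m := by ring
        _ ≤ D * (E m).card * Fintype.card β ^ m := Nat.mul_le_mul_right _ key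
        _ = D * ((E m).card * Fintype.card β ^ m) := by ring
        _ ≤ D * (D ^ m * Fintype.card (V → Fin M → β)) :=
          Nat.mul_le_mul_left _ (ih (by lia))
        _ = _ := by ring
  simpa using main M le_rfl

end Counting

/-! ### The iterated logarithm -/

/-- The iterated logarithm is well defined. -/
lemma exists_iterate_logb_le_one (x : ℝ) : ∃ i : ℕ, (Real.logb 2)^[i] x ≤ 1 := by
  have main : ∀ (m : ℕ) (x : ℝ), x ≤ m → ∃ i : ℕ, (Real.logb 2)^[i] x ≤ 1 := by
    intro m
    induction m with
    | zero => exact fun x hx => ⟨0, by simp at hx ⊢; linarith⟩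
    | succ m ih =>
      intro x hx
      by_cases h1 : x ≤ 1
      · exact ⟨0, h1⟩
      · push Not at h1
        have : Real.logb 2 x ≤ m := by
          rw [Real.logb_le_iff_le_rpow (by norm_num) (by linarith), Real.rpow_natCast]
          refine hx.trans ?_
          have : m + 1 ≤ 2 ^ m := Nat.lt_two_pow_self
          exact_mod_cast this
        obtain ⟨i, hi⟩ := ih _ this
        exact ⟨i + 1, by simpa using hi⟩
  obtain ⟨m, hm⟩ := exists_nat_ge x
  exact main m x hm

lemma one_le_logStar {n : ℕ} (hn : 2 ≤ n) : 1 ≤ logStar n := by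
  have h := Nat.sInf_mem (s := {i : ℕ | (Real.logb 2)^[i] (n : ℝ) ≤ 1})
    (exists_iterate_logb_le_one n)
  by_contra! h0
  have h1 : sInf {i : ℕ | (Real.logb 2)^[i] (n : ℝ) ≤ 1} = 0 := Nat.lt_one_iff.1 h0
  rw [h1] at h
  simp only [Set.mem_ofPred_eq, Function.iterate_zero, id_eq] at h
  have : n ≤ 1 := by exact_mod_cast h
  lia

/-! ### The algorithm and the recursion for its visible states -/

noncomputable section

/-- The part of the state of a node that its neighbours may see.

The node peels itself off the graph in round `level`. Then it tries random colours, avoiding the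
`forbidden` ones that neighbours of the same level have fixed, until it fixes its `colour`. -/
structure PeelCore where
  clock : ℕ
  ident : ℕ
  level : ℕ
  colour : Option ℕ
  forbidden : Set ℕ
  out : Option ℕ

namespace PeelCore

/-- The random number that is used in round `i`: the first `L` rounds are used for peeling,
the next `M` rounds for random trials. -/
def draw (L : ℕ) {M p : ℕ} (x : Fin M → Fin (p + 1)) (i : ℕ) : ℕ :=
  if h : L ≤ i ∧ i - L < M then x ⟨i - L, h.2⟩ else 0

open scoped Classical in
/-- The colour that a node has fixed, or the colour that it tries in this round. -/
def current (s : PeelCore) (x : ℕ) : ℕ :=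
  s.colour.getD (if x ∈ s.forbidden then sInf s.forbiddenᶜ else x)

open scoped Classical in
/-- The state after a round with the messages `I`. A message contains the identifier of the
sender, its state and its current colour. -/
def update (L M D p : ℕ) (s : PeelCore) (x : ℕ) (I : Set (ℕ × PeelCore × ℕ)) : PeelCore where
  clock := s.clock + 1
  ident := s.ident
  -- During peeling, `level = clock` means not yet peeled; a level that lags behind the clock is
  -- frozen.
  level := if s.level = s.clock ∧ D < {m ∈ I | m.2.1.level = s.clock}.ncard
    then s.level + 1 else s.level
  -- A clash is tolerated only with an uncoloured peer of larger identifier, so ties go to the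
  -- smallest identifier.
  colour := if L ≤ s.clock ∧ ∀ m ∈ I, m.2.1.level = s.level → m.2.2 = s.current x →
      m.2.1.colour = none ∧ s.ident < m.1
    then some (s.current x) else s.colour
  forbidden := s.forbidden ∪ {c | ∃ m ∈ I, m.2.1.level = s.level ∧ m.2.1.colour = some c}
  -- The old colour is tested, not the new one: a node stays awake for a round after fixing its
  -- colour and announces it before falling silent.
  out := if L + M ≤ s.clock then s.colour.map (fun c => s.level * (p + 1) + c) else none

end PeelCore

/-- Peel off vertices of degree at most `D` for `L` rounds, then colour the vertices that are
peeled off in the same round by `M` rounds of random trials with `p + 1` colours, and finally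
proceed greedily until all vertices are coloured. -/
def peelAlgorithm (L M D p : ℕ) : LocalAlgorithm where
  Seed := Fin M → Fin (p + 1)
  State := (Fin M → Fin (p + 1)) × PeelCore
  Msg := PeelCore × ℕ
  init i _ x := (x, ⟨0, i, 0, none, ∅, none⟩)
  send s _ := (s.2, s.2.current (PeelCore.draw L s.1 s.2.clock))
  recv s I := (s.1, s.2.update L M D p (PeelCore.draw L s.1 s.2.clock) I)
  output s := s.2.out

section Run

variable {V : Type} (G : SimpleGraph V) (ident : V → ℕ) (L M D p : ℕ)
  (ρ : V → Fin M → Fin (p + 1))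

open scoped Classical in
/-- The visible states of all nodes after `τ` rounds. -/
def peelRun : ℕ → V → PeelCore
  | 0, v => ⟨0, ident v, 0, none, ∅, none⟩
  | τ + 1, v => if (peelRun τ v).out = none then
      (peelRun τ v).update L M D p (PeelCore.draw L (ρ v) (peelRun τ v).clock)
        {m | ∃ u, G.Adj v u ∧ (peelRun τ u).out = none ∧ m = (ident u, peelRun τ u,
          (peelRun τ u).current (PeelCore.draw L (ρ u) (peelRun τ u).clock))}
      else peelRun τ v

lemma config_peelAlgorithm (τ : ℕ) (v : V) :
    (peelAlgorithm L M D p).config G ident ρ τ v = (ρ v, peelRun G ident L M D p ρ τ v) := by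
  induction τ generalizing v with
  | zero => rfl
  | succ τ ih =>
    have h : (peelAlgorithm L M D p).config G ident ρ (τ + 1) v =
        (peelAlgorithm L M D p).step G ident
          ((peelAlgorithm L M D p).config G ident ρ τ) v := by
      unfold LocalAlgorithm.config
      rw [Function.iterate_succ_apply']
    rw [h, LocalAlgorithm.step]
    have hout : ∀ u, (peelAlgorithm L M D p).output
        ((peelAlgorithm L M D p).config G ident ρ τ u) =
          (peelRun G ident L M D p ρ τ u).out := by
      intro u
      rw [ih]
      rfl
    have hin : (peelAlgorithm L M D p).inbox G ident
        ((peelAlgorithm L M D p).config G ident ρ τ) v =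
        {m | ∃ u, G.Adj v u ∧ (peelRun G ident L M D p ρ τ u).out = none ∧
          m = (ident u, peelRun G ident L M D p ρ τ u,
            (peelRun G ident L M D p ρ τ u).current
              (PeelCore.draw L (ρ u) (peelRun G ident L M D p ρ τ u).clock))} := by
      unfold LocalAlgorithm.inbox
      simp only [hout]
      simp only [ih]
      rfl
    rw [hin, peelRun, ← hout]
    split
    · rename_i c hc
      rw [if_neg (by rw [hc]; simp), ih]
    · rename_i hc
      rw [if_pos hc, ih]
      rfl

/-- The current colour of a node after `τ` rounds. -/
def peelCurrent (τ : ℕ) (v : V) : ℕ :=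
  (peelRun G ident L M D p ρ τ v).current
    (PeelCore.draw L (ρ v) (peelRun G ident L M D p ρ τ v).clock)

local notation "σ" => peelRun G ident L M D p ρ
local notation "κ" => peelCurrent G ident L M D p ρ

lemma peelRun_succ_of_out {τ : ℕ} {v : V} (h : (σ τ v).out ≠ none) : σ (τ + 1) v = σ τ v := by
  rw [peelRun, if_neg h]

lemma peelRun_clock_le (τ : ℕ) (v : V) : (σ τ v).clock ≤ τ := by
  induction τ with
  | zero => simp [peelRun]
  | succ τ ih =>
    rw [peelRun]
    split_ifs
    · simpa [PeelCore.update] using ih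
    · lia

lemma peelRun_out_mono {τ : ℕ} {v : V} (h : (σ (τ + 1) v).out = none) : (σ τ v).out = none := by
  by_contra h1
  rw [peelRun_succ_of_out _ _ _ _ _ _ _ h1] at h
  exact h1 h

lemma peelRun_clock {τ : ℕ} {v : V} (h : (σ τ v).out = none) : (σ τ v).clock = τ := by
  induction τ with
  | zero => simp [peelRun]
  | succ τ ih =>
    have h1 := peelRun_out_mono _ _ _ _ _ _ _ h
    rw [peelRun, if_pos h1]
    simp [PeelCore.update, ih h1]

lemma peelRun_ident (τ : ℕ) (v : V) : (σ τ v).ident = ident v := by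
  induction τ with
  | zero => simp [peelRun]
  | succ τ ih =>
    rw [peelRun]
    split_ifs <;> simpa [PeelCore.update] using ih

lemma peelRun_level_succ (hid : Function.Injective ident) {τ : ℕ} {v : V}
    (h : (σ τ v).out = none) :
    (σ (τ + 1) v).level = if (σ τ v).level = τ ∧
      D < {u | G.Adj v u ∧ (σ τ u).out = none ∧ (σ τ u).level = τ}.ncard
        then (σ τ v).level + 1 else (σ τ v).level := by
  rw [peelRun, if_pos h]
  simp only [PeelCore.update, peelRun_clock _ _ _ _ _ _ _ h]
  congr 3
  -- An inbox is a set; counting its messages counts neighbours because each message carries a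
  -- distinct identifier.
  have hinj : Function.Injective fun u => (ident u, σ τ u, κ τ u) :=
    fun u w huw => hid (congrArg Prod.fst huw)
  rw [← Set.ncard_image_of_injective _ hinj]
  congr 1
  ext m
  simp only [Set.mem_ofPred_eq, Set.mem_image]
  constructor
  · rintro ⟨⟨u, h1, h2, rfl⟩, h3⟩
    exact ⟨u, ⟨h1, h2, h3⟩, rfl⟩
  · rintro ⟨u, ⟨h1, h2, h3⟩, rfl⟩
    exact ⟨⟨u, h1, h2, rfl⟩, h3⟩

open scoped Classical in
lemma peelRun_colour_succ {τ : ℕ} {v : V} (h : (σ τ v).out = none) :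
    (σ (τ + 1) v).colour = if L ≤ τ ∧ ∀ u, G.Adj v u → (σ τ u).out = none →
      (σ τ u).level = (σ τ v).level → κ τ u = κ τ v →
        (σ τ u).colour = none ∧ ident v < ident u
      then some (κ τ v) else (σ τ v).colour := by
  rw [peelRun, if_pos h]
  simp only [PeelCore.update, peelRun_ident]
  refine if_congr ?_ rfl rfl
  rw [peelRun_clock _ _ _ _ _ _ _ h]
  refine and_congr_right fun _ => ⟨fun H u h1 h2 h3 h4 => H _ ⟨u, h1, h2, rfl⟩ h3 ?_, ?_⟩
  · simpa [peelCurrent, peelRun_clock _ _ _ _ _ _ _ h] using h4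
  · rintro H _ ⟨u, h1, h2, rfl⟩ h3 h4
    refine H u h1 h2 h3 ?_
    simpa [peelCurrent, peelRun_clock _ _ _ _ _ _ _ h] using h4

lemma peelRun_forbidden_succ {τ : ℕ} {v : V} (h : (σ τ v).out = none) :
    (σ (τ + 1) v).forbidden = (σ τ v).forbidden ∪ {c | ∃ u, G.Adj v u ∧ (σ τ u).out = none ∧
      (σ τ u).level = (σ τ v).level ∧ (σ τ u).colour = some c} := by
  rw [peelRun, if_pos h]
  simp only [PeelCore.update]
  congr 1
  ext c
  constructor
  · rintro ⟨_, ⟨u, h1, h2, rfl⟩, h3, h4⟩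
    exact ⟨u, h1, h2, h3, h4⟩
  · rintro ⟨u, h1, h2, h3, h4⟩
    exact ⟨_, ⟨u, h1, h2, rfl⟩, h3, h4⟩

lemma peelRun_out_succ {τ : ℕ} {v : V} (h : (σ τ v).out = none) :
    (σ (τ + 1) v).out = if L + M ≤ τ then
      (σ τ v).colour.map (fun c => (σ τ v).level * (p + 1) + c) else none := by
  rw [peelRun, if_pos h]
  simp only [PeelCore.update, peelRun_clock _ _ _ _ _ _ _ h]

end Run

end

noncomputable section

/-! ### Peeling: degrees within layers and number of layers -/

section Peeling

variable {V : Type} (G : SimpleGraph V) (ident : V → ℕ) (L M D p : ℕ)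
  (ρ : V → Fin M → Fin (p + 1))

local notation "σ" => peelRun G ident L M D p ρ

lemma peelRun_out_eq_none {τ : ℕ} (hτ : τ ≤ L + M) (v : V) : (σ τ v).out = none := by
  induction τ with
  | zero => simp [peelRun]
  | succ τ ih => rw [peelRun_out_succ _ _ _ _ _ _ _ (ih (by lia)), if_neg (by lia)]

lemma peelRun_level_le (hid : Function.Injective ident) (τ : ℕ) (v : V) :
    (σ τ v).level ≤ τ := by
  induction τ with
  | zero => simp [peelRun]
  | succ τ ih =>
    by_cases h : (σ τ v).out = none
    · rw [peelRun_level_succ _ _ _ _ _ _ _ hid h]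
      split_ifs <;> lia
    · rw [peelRun_succ_of_out _ _ _ _ _ _ _ h]
      lia

lemma peelRun_level_succ_of_ne (hid : Function.Injective ident) {τ : ℕ} {v : V}
    (hv : (σ τ v).level ≠ τ) : (σ (τ + 1) v).level = (σ τ v).level := by
  by_cases h : (σ τ v).out = none
  · rw [peelRun_level_succ _ _ _ _ _ _ _ hid h, if_neg (fun H => hv H.1)]
  · rw [peelRun_succ_of_out _ _ _ _ _ _ _ h]

/-- A node that has been peeled off has few neighbours of the same level or higher. -/
lemma peelRun_ncard_level_ge [Finite V] (hid : Function.Injective ident) {τ : ℕ} (hτ : τ ≤ L)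
    (v : V) (hv : (σ τ v).level < τ) :
    {u | G.Adj v u ∧ (σ τ v).level ≤ (σ τ u).level}.ncard ≤ D := by
  induction τ generalizing v with
  | zero => lia
  | succ τ ih =>
    have hout : ∀ u, (σ τ u).out = none := peelRun_out_eq_none _ _ _ _ _ _ _ (by lia)
    have hle : ∀ u, (σ τ u).level ≤ τ := peelRun_level_le _ _ _ _ _ _ _ hid τ
    rcases (hle v).lt_or_eq with h | h
    · refine (Set.ncard_le_ncard ?_ (Set.toFinite _)).trans (ih (by lia) v h)
      rw [peelRun_level_succ_of_ne _ _ _ _ _ _ _ hid h.ne]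
      rintro u ⟨h1, h2⟩
      refine ⟨h1, ?_⟩
      rcases (hle u).lt_or_eq with h3 | h3
      · rwa [peelRun_level_succ_of_ne _ _ _ _ _ _ _ hid h3.ne] at h2
      · lia
    · have h1 := peelRun_level_succ _ _ _ _ _ _ _ hid (hout v)
      split_ifs at h1 with h2
      · lia
      · have h3 : {u | G.Adj v u ∧ (σ τ u).out = none ∧ (σ τ u).level = τ}.ncard ≤ D := by
          by_contra! h4
          exact h2 ⟨h, h4⟩
        refine (Set.ncard_le_ncard ?_ (Set.toFinite _)).trans h3
        rintro u ⟨h4, h5⟩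
        refine ⟨h4, hout u, ?_⟩
        by_contra h6
        rw [peelRun_level_succ_of_ne _ _ _ _ _ _ _ hid h6] at h5
        have := hle u
        lia

/-- If in every induced subgraph only a fraction `1 / s` of the vertices has a degree greater
than `D`, then peeling ends after `log n / log s` rounds. -/
lemma peelRun_level_lt [Fintype V] (hid : Function.Injective ident) {s : ℝ} (hs : 0 ≤ s)
    (hpeel : ∀ S T : Finset V, T ⊆ S → (∀ v ∈ T, D < {u | G.Adj v u ∧ u ∈ S}.ncard) →
      T.card * s ≤ S.card)
    (hL : Fintype.card V < s ^ L) (v : V) : (σ L v).level < L := by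
  classical
  have main : ∀ τ ≤ L,
      ((Finset.univ.filter fun u => (σ τ u).level = τ).card : ℝ) * s ^ τ ≤ Fintype.card V := by
    intro τ
    induction τ with
    | zero =>
      intro _
      simpa using Finset.card_le_univ (Finset.univ.filter fun u => (σ 0 u).level = 0)
    | succ τ ih =>
      intro hτ
      -- Vertices that survive the round are those with more than `D` unpeeled neighbours, so each
      -- round divides the number of survivors by at least `s`.
      have h1 := hpeel (Finset.univ.filter fun u => (σ τ u).level = τ)
        (Finset.univ.filter fun u => (σ (τ + 1) u).level = τ + 1) ?_ ?_
      · calc _ = ((Finset.univ.filter fun u => (σ (τ + 1) u).level = τ + 1).card : ℝ) * s * s ^ τ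
            := by ring
          _ ≤ ((Finset.univ.filter fun u => (σ τ u).level = τ).card : ℝ) * s ^ τ := by gcongr
          _ ≤ _ := ih (by lia)
      · intro u
        simp only [Finset.mem_filter, Finset.mem_univ, true_and]
        intro h
        by_contra h1
        rw [peelRun_level_succ_of_ne _ _ _ _ _ _ _ hid h1] at h
        have := peelRun_level_le G ident L M D p ρ hid τ u
        lia
      · intro u
        simp only [Finset.mem_filter, Finset.mem_univ, true_and]
        intro h
        have hout : ∀ u, (σ τ u).out = none := peelRun_out_eq_none _ _ _ _ _ _ _ (by lia)
        rw [peelRun_level_succ _ _ _ _ _ _ _ hid (hout u)] at h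
        split_ifs at h with h1
        · simpa [hout] using h1.2
        · have := peelRun_level_le G ident L M D p ρ hid τ u
          lia
  refine (peelRun_level_le _ _ _ _ _ _ _ hid L v).lt_of_ne fun h => ?_
  have h1 : 1 ≤ (Finset.univ.filter fun u => (σ L u).level = L).card :=
    Finset.card_pos.2 ⟨v, by simpa using h⟩
  have h2 : (1 : ℝ) ≤ (Finset.univ.filter fun u => (σ L u).level = L).card := by
    exact_mod_cast h1
  have h3 := main L le_rfl
  have h4 : 0 ≤ s ^ L := by positivity
  nlinarith

end Peeling

/-! ### Permanence of colours and levels -/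

section Colouring

variable {V : Type} (G : SimpleGraph V) (ident : V → ℕ) (L M D p : ℕ)
  (ρ : V → Fin M → Fin (p + 1))

local notation "σ" => peelRun G ident L M D p ρ
local notation "κ" => peelCurrent G ident L M D p ρ

lemma peelRun_colour_eq_none {τ : ℕ} (hτ : τ ≤ L) (v : V) : (σ τ v).colour = none := by
  classical
  induction τ with
  | zero => simp [peelRun]
  | succ τ ih =>
    rw [peelRun_colour_succ _ _ _ _ _ _ _ (peelRun_out_eq_none _ _ _ _ _ _ _ (by lia) v),
      if_neg (by lia), ih (by lia)]

lemma peelRun_forbidden_eq_empty {τ : ℕ} (hτ : τ ≤ L) (v : V) : (σ τ v).forbidden = ∅ := by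
  induction τ with
  | zero => simp [peelRun]
  | succ τ ih =>
    rw [peelRun_forbidden_succ _ _ _ _ _ _ _ (peelRun_out_eq_none _ _ _ _ _ _ _ (by lia) v),
      ih (by lia)]
    simp [peelRun_colour_eq_none G ident L M D p ρ (show τ ≤ L by lia)]

lemma peelCurrent_of_colour {τ : ℕ} {v : V} {c : ℕ} (h : (σ τ v).colour = some c) :
    κ τ v = c := by
  simp [peelCurrent, PeelCore.current, h]

/-- Fixed colours are irrevocable. -/
lemma peelRun_colour_succ_of_some {τ : ℕ} {v : V} {c : ℕ} (h : (σ τ v).colour = some c) :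
    (σ (τ + 1) v).colour = some c := by
  classical
  by_cases h1 : (σ τ v).out = none
  · rw [peelRun_colour_succ _ _ _ _ _ _ _ h1, peelCurrent_of_colour _ _ _ _ _ _ _ h, h, ite_self]
  · rwa [peelRun_succ_of_out _ _ _ _ _ _ _ h1]

lemma peelRun_colour_of_le {τ τ' : ℕ} (hτ : τ ≤ τ') {v : V} {c : ℕ}
    (h : (σ τ v).colour = some c) : (σ τ' v).colour = some c := by
  induction hτ with
  | refl => exact h
  | step _ ih => exact peelRun_colour_succ_of_some _ _ _ _ _ _ _ ih

lemma peelRun_colour_eq_none_of_le {τ τ' : ℕ} (hτ : τ ≤ τ') {v : V}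
    (h : (σ τ' v).colour = none) : (σ τ v).colour = none := by
  by_contra h1
  obtain ⟨c, hc⟩ := Option.ne_none_iff_exists'.1 h1
  simp [peelRun_colour_of_le _ _ _ _ _ _ _ hτ hc] at h

lemma peelRun_level (hid : Function.Injective ident) (hlev : ∀ v, (σ L v).level < L)
    {τ : ℕ} (hτ : L ≤ τ) (v : V) : (σ τ v).level = (σ L v).level := by
  induction hτ with
  | refl => rfl
  | @step m hm ih =>
    have h1 := hlev v
    have h2 : L ≤ m := hm
    rw [Nat.succ_eq_add_one, peelRun_level_succ_of_ne _ _ _ _ _ _ _ hid, ih]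
    lia

end Colouring

end

noncomputable section

lemma PeelCore.draw_le (L : ℕ) {M p : ℕ} (x : Fin M → Fin (p + 1)) (i : ℕ) :
    PeelCore.draw L x i ≤ p := by
  unfold PeelCore.draw
  split_ifs
  · exact Nat.lt_succ_iff.1 (Fin.is_lt _)
  · exact Nat.zero_le _

/-! ### Properness and termination for every seed -/

section Invariants

variable {V : Type} (G : SimpleGraph V) (ident : V → ℕ) (L M D p : ℕ)
  (ρ : V → Fin M → Fin (p + 1))

local notation "σ" => peelRun G ident L M D p ρ
local notation "κ" => peelCurrent G ident L M D p ρ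

/-- The neighbours of `v` that are peeled off in the same round as `v`. -/
def peelPeers (v : V) : Set V := {u | G.Adj v u ∧ (σ L u).level = (σ L v).level}

local notation "π" => peelPeers G ident L M D p ρ

lemma mem_peelPeers_comm {u v : V} : u ∈ π v ↔ v ∈ π u :=
  ⟨fun h => ⟨h.1.symm, h.2.symm⟩, fun h => ⟨h.1.symm, h.2.symm⟩⟩

lemma ncard_peelPeers_le [Finite V] (hid : Function.Injective ident)
    (hlev : ∀ v, (σ L v).level < L) (v : V) : (π v).ncard ≤ D :=
  (Set.ncard_le_ncard (t := {u | G.Adj v u ∧ (σ L v).level ≤ (σ L u).level})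
    (fun _ hu => ⟨hu.1, hu.2.ge⟩) (Set.toFinite _)).trans
    (peelRun_ncard_level_ge G ident L M D p ρ hid le_rfl v (hlev v))

lemma exists_peer_of_mem_forbidden (hid : Function.Injective ident)
    (hlev : ∀ v, (σ L v).level < L) {τ : ℕ} (hτ : L ≤ τ) {v : V} {c : ℕ}
    (hc : c ∈ (σ τ v).forbidden) : ∃ u ∈ π v, (σ τ u).colour = some c := by
  induction hτ with
  | refl => simp [peelRun_forbidden_eq_empty] at hc
  | @step τ hτ ih =>
    have up : (∃ u ∈ π v, (σ τ u).colour = some c) →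
        ∃ u ∈ π v, (σ (τ + 1) u).colour = some c := by
      rintro ⟨u, h1, h2⟩
      exact ⟨u, h1, peelRun_colour_succ_of_some _ _ _ _ _ _ _ h2⟩
    apply up
    by_cases h : (σ τ v).out = none
    · rw [Nat.succ_eq_add_one, peelRun_forbidden_succ _ _ _ _ _ _ _ h] at hc
      rcases hc with hc | ⟨u, h1, -, h3, h4⟩
      · exact ih hc
      · rw [peelRun_level _ _ _ _ _ _ _ hid hlev hτ, peelRun_level _ _ _ _ _ _ _ hid hlev hτ] at h3
        exact ⟨u, ⟨h1, h3⟩, h4⟩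
    · rw [Nat.succ_eq_add_one, peelRun_succ_of_out _ _ _ _ _ _ _ h] at hc
      exact ih hc

/-- Pigeonhole: forbidden colours are fixed colours of peers, and at most `D ≤ p` peers cannot block
`p + 1` colours. -/
lemma exists_le_not_mem_forbidden [Finite V] (hid : Function.Injective ident)
    (hlev : ∀ v, (σ L v).level < L) (hD : D ≤ p) {τ : ℕ} (hτ : L ≤ τ) (v : V) :
    ∃ c ≤ p, c ∉ (σ τ v).forbidden := by
  by_contra! h
  have h1 : Set.Iic p ⊆ κ τ '' π v := by
    intro c hc
    obtain ⟨u, hu, huc⟩ := exists_peer_of_mem_forbidden G ident L M D p ρ hid hlev hτ (h c hc)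
    exact ⟨u, hu, peelCurrent_of_colour _ _ _ _ _ _ _ huc⟩
  have h2 := Set.ncard_le_ncard h1 (Set.toFinite _)
  have h3 := Set.ncard_image_le (f := κ τ) (Set.toFinite (π v))
  have h4 := ncard_peelPeers_le G ident L M D p ρ hid hlev v
  have h5 : (Set.Iic p).ncard = p + 1 := by
    rw [← Finset.coe_Iic, Set.ncard_coe_finset, Nat.card_Iic]
  lia

lemma peelCurrent_not_mem_forbidden [Finite V] (hid : Function.Injective ident)
    (hlev : ∀ v, (σ L v).level < L) (hD : D ≤ p) {τ : ℕ} (hτ : L ≤ τ) {v : V}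
    (hv : (σ τ v).colour = none) : κ τ v ∉ (σ τ v).forbidden := by
  obtain ⟨c, -, hc⟩ := exists_le_not_mem_forbidden G ident L M D p ρ hid hlev hD hτ v
  rw [peelCurrent, PeelCore.current, hv, Option.getD_none]
  split_ifs with h
  · exact Nat.sInf_mem (s := (σ τ v).forbiddenᶜ) ⟨c, hc⟩
  · exact h

lemma peelRun_colour_le [Finite V] (hid : Function.Injective ident)
    (hlev : ∀ v, (σ L v).level < L) (hD : D ≤ p) {τ : ℕ} {v : V} {c : ℕ}
    (hc : (σ τ v).colour = some c) : c ≤ p := by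
  classical
  induction τ generalizing c with
  | zero => simp [peelRun] at hc
  | succ τ ih =>
    by_cases h : (σ τ v).out = none
    · cases hcol : (σ τ v).colour with
      | some c' =>
        have := peelRun_colour_succ_of_some _ _ _ _ _ _ _ hcol
        rw [hc] at this
        cases this
        exact ih hcol
      | none =>
        rw [peelRun_colour_succ _ _ _ _ _ _ _ h, hcol] at hc
        split_ifs at hc with h1
        cases hc
        obtain ⟨c, hcp, hc⟩ := exists_le_not_mem_forbidden G ident L M D p ρ hid hlev hD h1.1 v
        rw [peelCurrent, PeelCore.current, hcol, Option.getD_none]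
        split_ifs with h2
        · exact (Nat.sInf_le hc).trans hcp
        · exact PeelCore.draw_le _ _ _
    · rw [peelRun_succ_of_out _ _ _ _ _ _ _ h] at hc
      exact ih hc

lemma peelRun_out_eq (hid : Function.Injective ident) (hlev : ∀ v, (σ L v).level < L) {τ : ℕ}
    {v : V} (h : (σ τ v).out ≠ none) : ∃ c, (σ τ v).colour = some c ∧
      (σ τ v).out = some ((σ L v).level * (p + 1) + c) := by
  induction τ with
  | zero => simp [peelRun] at h
  | succ τ ih =>
    by_cases h1 : (σ τ v).out = none
    · rw [peelRun_out_succ _ _ _ _ _ _ _ h1] at h ⊢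
      split_ifs at h ⊢ with h2
      · simp only [ne_eq, Option.map_eq_none_iff] at h
        obtain ⟨c, hc⟩ := Option.ne_none_iff_exists'.1 h
        exact ⟨c, peelRun_colour_succ_of_some _ _ _ _ _ _ _ hc, by
          rw [hc, Option.map_some, peelRun_level _ _ _ _ _ _ _ hid hlev (by lia)]⟩
      · exact absurd rfl h
    · rw [peelRun_succ_of_out _ _ _ _ _ _ _ h1]
      exact ih h1

lemma peelRun_out_eq_none_of_colour (hid : Function.Injective ident)
    (hlev : ∀ v, (σ L v).level < L) {τ : ℕ} {v : V} (h : (σ τ v).colour = none) :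
    (σ τ v).out = none := by
  by_contra h1
  obtain ⟨c, hc, -⟩ := peelRun_out_eq _ _ _ _ _ _ _ hid hlev h1
  simp [hc] at h

/-- A node knows the colours of the peers that have announced them. -/
lemma mem_forbidden_succ (hid : Function.Injective ident) (hlev : ∀ v, (σ L v).level < L)
    {τ : ℕ} (hτ : L ≤ τ) {u v : V} (hu : u ∈ π v) {c : ℕ} (hc : (σ τ u).colour = some c)
    (hv : (σ (τ + 1) v).colour = none) : c ∈ (σ (τ + 1) v).forbidden := by
  induction τ with
  | zero => simp [peelRun] at hc
  | succ τ ih =>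
    have hv1 := peelRun_colour_eq_none_of_le G ident L M D p ρ (Nat.le_succ (τ + 1)) hv
    have hv2 := peelRun_out_eq_none_of_colour _ _ _ _ _ _ _ hid hlev hv1
    rw [peelRun_forbidden_succ _ _ _ _ _ _ _ hv2]
    by_cases h : (σ (τ + 1) u).out = none
    · right
      refine ⟨u, hu.1, h, ?_, hc⟩
      rw [peelRun_level _ _ _ _ _ _ _ hid hlev hτ, peelRun_level _ _ _ _ _ _ _ hid hlev hτ, hu.2]
    -- A silent peer had its colour while still awake, so the announcement was received in an
    -- earlier round.
    · left
      have hL : L ≤ τ := by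
        by_contra! hL
        exact h (peelRun_out_eq_none _ _ _ _ _ _ _ (by lia) _)
      refine ih hL ?_ hv1
      by_cases h1 : (σ τ u).out = none
      · rw [peelRun_out_succ _ _ _ _ _ _ _ h1] at h
        split_ifs at h
        · simp only [Option.map_eq_none_iff] at h
          obtain ⟨c', hc'⟩ := Option.ne_none_iff_exists'.1 h
          have := peelRun_colour_succ_of_some _ _ _ _ _ _ _ hc'
          rw [hc] at this
          rw [hc', this]
        · exact absurd rfl h
      · rwa [peelRun_succ_of_out _ _ _ _ _ _ _ h1] at hc

/-- Silence loses no information: a node outputs a colour it already held one round before, so its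
last message has told the colour to every peer. Unlike in `mem_forbidden_succ`, there is no delay.
-/
lemma mem_forbidden_of_out (hid : Function.Injective ident) (hlev : ∀ v, (σ L v).level < L)
    {τ : ℕ} {u v : V} (hu : u ∈ π v) {c : ℕ} (hc : (σ τ u).colour = some c)
    (hout : (σ τ u).out ≠ none) (hv : (σ τ v).colour = none) : c ∈ (σ τ v).forbidden := by
  cases τ with
  | zero => simp [peelRun] at hc
  | succ τ =>
    by_cases h1 : (σ τ u).out = none
    · rw [peelRun_out_succ _ _ _ _ _ _ _ h1] at hout
      split_ifs at hout
      · simp only [ne_eq, Option.map_eq_none_iff] at hout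
        obtain ⟨c', hc'⟩ := Option.ne_none_iff_exists'.1 hout
        have := peelRun_colour_succ_of_some _ _ _ _ _ _ _ hc'
        rw [hc] at this
        cases this
        exact mem_forbidden_succ _ _ _ _ _ _ _ hid hlev (by lia) hu hc' hv
      · exact absurd rfl hout
    · have hL : L ≤ τ := by
        by_contra! hL
        exact h1 (peelRun_out_eq_none _ _ _ _ _ _ _ (by lia) _)
      rw [peelRun_succ_of_out _ _ _ _ _ _ _ h1] at hc
      exact mem_forbidden_succ _ _ _ _ _ _ _ hid hlev hL hu hc hv

open scoped Classical in
lemma peelRun_colour_succ' (hid : Function.Injective ident) (hlev : ∀ v, (σ L v).level < L)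
    {τ : ℕ} (hτ : L ≤ τ) {v : V} (hv : (σ τ v).colour = none) :
    (σ (τ + 1) v).colour = if ∀ u ∈ π v, (σ τ u).out = none → κ τ u = κ τ v →
        (σ τ u).colour = none ∧ ident v < ident u
      then some (κ τ v) else none := by
  rw [peelRun_colour_succ _ _ _ _ _ _ _
    (peelRun_out_eq_none_of_colour _ _ _ _ _ _ _ hid hlev hv), hv]
  refine if_congr ?_ rfl rfl
  simp only [peelRun_level _ _ _ _ _ _ _ hid hlev hτ, hτ, true_and]
  exact ⟨fun H u hu h => H u hu.1 h hu.2, fun H u h1 h2 h3 => H u ⟨h1, h3⟩ h2⟩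

/-- Fixed colours of peers are distinct. -/
lemma peelRun_colour_ne [Finite V] (hid : Function.Injective ident)
    (hlev : ∀ v, (σ L v).level < L) (hD : D ≤ p) (τ : ℕ) {u v : V} (hu : u ∈ π v) {c : ℕ}
    (hc : (σ τ u).colour = some c) : (σ τ v).colour ≠ some c := by
  classical
  induction τ generalizing u v c with
  | zero => simp [peelRun] at hc
  | succ τ ih =>
    intro hv
    have hL : L ≤ τ := by
      by_contra! hL
      rw [peelRun_colour_eq_none _ _ _ _ _ _ _ (by lia)] at hc
      simp at hc
    have step : ∀ {u v}, u ∈ π v → (σ τ v).colour = none → (σ (τ + 1) v).colour = some c →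
        (σ τ u).colour ≠ some c ∧ ((σ τ u).colour = none → κ τ u = c → ident v < ident u) := by
      intro u v hu hv0 hv
      rw [peelRun_colour_succ' _ _ _ _ _ _ _ hid hlev hL hv0] at hv
      split_ifs at hv with h
      cases hv
      constructor
      · intro h1
        have h2 : (σ τ u).out = none := by
          by_contra h2
          exact peelCurrent_not_mem_forbidden _ _ _ _ _ _ _ hid hlev hD hL hv0
            (mem_forbidden_of_out _ _ _ _ _ _ _ hid hlev hu h1 h2 hv0)
        have h3 := (h u hu h2 (peelCurrent_of_colour _ _ _ _ _ _ _ h1)).1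
        rw [h1] at h3
        simp at h3
      · intro h1 h2
        exact (h u hu (peelRun_out_eq_none_of_colour _ _ _ _ _ _ _ hid hlev h1) h2).2
    have cur : ∀ {v}, (σ τ v).colour = none → (σ (τ + 1) v).colour = some c → κ τ v = c := by
      intro v h0 h1
      rw [peelRun_colour_succ' _ _ _ _ _ _ _ hid hlev hL h0] at h1
      split_ifs at h1
      exact Option.some.inj h1
    have old : ∀ {v}, (σ (τ + 1) v).colour = some c → (σ τ v).colour ≠ none →
        (σ τ v).colour = some c := by
      intro v h0 h1
      obtain ⟨c', hc'⟩ := Option.ne_none_iff_exists'.1 h1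
      have := peelRun_colour_succ_of_some _ _ _ _ _ _ _ hc'
      rw [h0] at this
      rw [hc', this]
    have hu' := (mem_peelPeers_comm G ident L M D p ρ).1 hu
    by_cases hu0 : (σ τ u).colour = none
    · by_cases hv0 : (σ τ v).colour = none
      -- If both fix the same colour in one round, each identifier would be smaller than the other.
      · have h1 := (step hu hv0 hv).2 hu0 (cur hu0 hc)
        have h2 := (step hu' hu0 hc).2 hv0 (cur hv0 hv)
        lia
      · exact (step hu' hu0 hc).1 (old hv hv0)
    · by_cases hv0 : (σ τ v).colour = none
      · exact (step hu hv0 hv).1 (old hc hu0)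
      · exact ih hu (old hc hu0) (old hv hv0)

/-- In any two consecutive rounds some node fixes its colour. -/
lemma exists_colour_fixed [Finite V] (hid : Function.Injective ident)
    (hlev : ∀ v, (σ L v).level < L) (hD : D ≤ p) {τ : ℕ} (hτ : L ≤ τ)
    (h : ∃ v, (σ τ v).colour = none) :
    ∃ v, (σ τ v).colour = none ∧ (σ (τ + 2) v).colour ≠ none := by
  classical
  by_contra! H
  have H1 : ∀ v, (σ τ v).colour = none → (σ (τ + 1) v).colour = none := fun v hv =>
    peelRun_colour_eq_none_of_le _ _ _ _ _ _ _ (Nat.le_succ (τ + 1)) (H v hv)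
  -- If nobody fixes a colour in the first round, then in the second the smallest uncoloured
  -- identifier knows all fixed colours of its peers and wins all remaining ties. Two rounds are
  -- needed because announcements arrive one round late.
  obtain ⟨v, hv, hmin⟩ := Set.exists_min_image {v | (σ τ v).colour = none} ident
    (Set.toFinite _) h
  have h1 := peelRun_colour_succ' _ _ _ _ _ _ _ hid hlev (τ := τ + 1) (by lia) (H1 v hv)
  rw [H v hv, if_pos] at h1
  · simp at h1
  · intro u hu hout hκ
    have hu0 : (σ τ u).colour = none := by
      by_contra h2
      obtain ⟨c, hc⟩ := Option.ne_none_iff_exists'.1 h2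
      have h3 := mem_forbidden_succ _ _ _ _ _ _ _ hid hlev hτ hu hc (H1 v hv)
      rw [peelCurrent_of_colour _ _ _ _ _ _ _
        (peelRun_colour_succ_of_some _ _ _ _ _ _ _ hc)] at hκ
      rw [hκ] at h3
      exact peelCurrent_not_mem_forbidden _ _ _ _ _ _ _ hid hlev hD (by lia) (H1 v hv) h3
    refine ⟨H1 u hu0, lt_of_le_of_ne (hmin u hu0) fun h2 => ?_⟩
    exact hu.1.ne (hid h2)

/-- After `2 * |V|` rounds of colouring all nodes have fixed their colours. -/
lemma peelRun_colour_ne_none [Fintype V] (hid : Function.Injective ident)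
    (hlev : ∀ v, (σ L v).level < L) (hD : D ≤ p) (v : V) :
    (σ (L + 2 * Fintype.card V) v).colour ≠ none := by
  classical
  have main : ∀ j, (Finset.univ.filter fun u => (σ (L + 2 * j) u).colour = none).card ≤
      Fintype.card V - j := by
    intro j
    induction j with
    | zero => exact Finset.card_le_univ _
    | succ j ih =>
      have hsub : (Finset.univ.filter fun u => (σ (L + 2 * (j + 1)) u).colour = none) ⊆
          Finset.univ.filter fun u => (σ (L + 2 * j) u).colour = none := by
        intro u
        simp only [Finset.mem_filter, Finset.mem_univ, true_and]
        exact peelRun_colour_eq_none_of_le _ _ _ _ _ _ _ (by lia)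
      by_cases h : ∃ u, (σ (L + 2 * j) u).colour = none
      · obtain ⟨u, h1, h2⟩ :=
          exists_colour_fixed _ _ _ _ _ _ _ hid hlev hD (Nat.le_add_right L (2 * j)) h
        have := Finset.card_lt_card (Finset.ssubset_iff_of_subset hsub |>.2
          ⟨u, by simpa using h1, by simpa [mul_add, ← add_assoc] using h2⟩)
        lia
      · push Not at h
        have h0 : (Finset.univ.filter fun u => (σ (L + 2 * j) u).colour = none) = ∅ := by
          simpa [Finset.filter_eq_empty_iff] using h
        rw [h0, Finset.subset_empty] at hsub
        rw [hsub]
        simp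
  intro h
  have h1 := main (Fintype.card V)
  rw [Nat.sub_self, Nat.le_zero, Finset.card_eq_zero] at h1
  exact Finset.notMem_empty v (h1 ▸ by simpa using h)

lemma peelRun_out_ne_none {τ : ℕ} (hτ : L + M ≤ τ) {v : V} (h : (σ τ v).colour ≠ none) :
    (σ (τ + 1) v).out ≠ none := by
  by_cases h1 : (σ τ v).out = none
  · rw [peelRun_out_succ _ _ _ _ _ _ _ h1, if_pos hτ]
    simpa using h
  · rwa [peelRun_succ_of_out _ _ _ _ _ _ _ h1]

end Invariants

end

noncomputable section

/-! ### From rare bad seeds to expectation and probability -/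

section Bounds

variable {V : Type} (G : SimpleGraph V) (ident : V → ℕ)

/-- Bounds for the number of rounds in terms of a rare set of bad seeds. -/
lemma LocalAlgorithm.rounds_bounds [Fintype V] [DecidableEq V] (A : LocalAlgorithm)
    (bad : Finset (V → A.Seed)) (T₁ T₂ : ℕ) {ε T δ : ℝ}
    (h₁ : ∀ ρ ∉ bad, A.rounds G ident ρ ≤ (T₁ : ℝ≥0∞))
    (h₂ : ∀ ρ, A.rounds G ident ρ ≤ ((T₁ + T₂ : ℕ) : ℝ≥0∞))
    (hbad : (bad.card : ℝ) ≤ ε * Fintype.card (V → A.Seed))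
    (hT : T₁ + T₂ * ε ≤ T) (hδ : ε ≤ δ) :
    A.expectedRounds G ident ≤ ENNReal.ofReal T ∧
      1 - δ ≤ A.prob {ρ : V → A.Seed | A.rounds G ident ρ ≤ ENNReal.ofReal T} := by
  classical
  have hN : (0 : ℝ) < Fintype.card (V → A.Seed) := by
    exact_mod_cast Fintype.card_pos
  have hε : 0 ≤ ε := nonneg_of_mul_nonneg_left ((Nat.cast_nonneg _).trans hbad) hN
  constructor
  · have hsum : ∑ ρ : V → A.Seed, A.rounds G ident ρ ≤
        ((Fintype.card (V → A.Seed) * T₁ + bad.card * T₂ : ℕ) : ℝ≥0∞) := by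
      calc ∑ ρ : V → A.Seed, A.rounds G ident ρ
          ≤ ∑ ρ : V → A.Seed, ((T₁ + if ρ ∈ bad then T₂ else 0 : ℕ) : ℝ≥0∞) := by
            refine Finset.sum_le_sum fun ρ _ => ?_
            split_ifs with h
            · exact h₂ ρ
            · exact h₁ ρ h
        _ = ((Fintype.card (V → A.Seed) * T₁ + bad.card * T₂ : ℕ) : ℝ≥0∞) := by
            rw [← Nat.cast_sum, Finset.sum_add_distrib, Finset.sum_const, Finset.sum_ite_mem,
              Finset.univ_inter, Finset.sum_const, Finset.card_univ, smul_eq_mul, smul_eq_mul]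
    refine ENNReal.div_le_of_le_mul (hsum.trans ?_)
    rw [← ENNReal.ofReal_natCast, ← ENNReal.ofReal_natCast (Fintype.card (V → A.Seed)),
      ← ENNReal.ofReal_mul' hN.le]
    refine ENNReal.ofReal_le_ofReal ?_
    push_cast
    have h3 : (bad.card : ℝ) * T₂ ≤ ε * Fintype.card (V → A.Seed) * T₂ := by gcongr
    have h4 : (T₁ + T₂ * ε) * Fintype.card (V → A.Seed) ≤ T * Fintype.card (V → A.Seed) := by
      gcongr
    linarith
  · have hT₁ : (T₁ : ℝ) ≤ T := le_trans (by simp; positivity) hT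
    have hcover : (Set.univ : Set (V → A.Seed)) ⊆
        {ρ : V → A.Seed | A.rounds G ident ρ ≤ ENNReal.ofReal T} ∪ bad := by
      intro ρ _
      by_cases h : ρ ∈ bad
      · exact Or.inr h
      · left
        refine (h₁ ρ h).trans ?_
        rw [← ENNReal.ofReal_natCast]
        exact ENNReal.ofReal_le_ofReal hT₁
    have h3 := (Set.ncard_le_ncard hcover (Set.toFinite _)).trans (Set.ncard_union_le _ _)
    rw [Set.ncard_univ, Set.ncard_coe_finset, Nat.card_eq_fintype_card] at h3
    have h4 : (Fintype.card (V → A.Seed) : ℝ) ≤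
        {ρ : V → A.Seed | A.rounds G ident ρ ≤ ENNReal.ofReal T}.ncard + bad.card := by
      exact_mod_cast h3
    rw [LocalAlgorithm.prob, Nat.card_eq_fintype_card, le_div_iff₀ hN]
    have h5 : ε * Fintype.card (V → A.Seed) ≤ δ * Fintype.card (V → A.Seed) := by gcongr
    linarith

end Bounds

/-! ### Failure probability of the random trials -/

section Analysis

variable {V : Type} (G : SimpleGraph V) (ident : V → ℕ) (L M D p : ℕ)

/-- Causality: a round uses only its own draw, so later draws cannot influence the present state. -/
lemma peelRun_congr {ρ ρ' : V → Fin M → Fin (p + 1)} {T : ℕ}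
    (h : ∀ u, ∀ i < T, PeelCore.draw L (ρ u) i = PeelCore.draw L (ρ' u) i) {τ : ℕ} (hτ : τ ≤ T) :
    peelRun G ident L M D p ρ τ = peelRun G ident L M D p ρ' τ := by
  induction τ with
  | zero => rfl
  | succ τ ih =>
    funext v
    have h1 : ∀ u, PeelCore.draw L (ρ u) (peelRun G ident L M D p ρ' τ u).clock =
        PeelCore.draw L (ρ' u) (peelRun G ident L M D p ρ' τ u).clock := fun u =>
      h u _ (lt_of_le_of_lt (peelRun_clock_le G ident L M D p ρ' τ u) (by lia))
    simp only [peelRun, ih (by lia), h1]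

open scoped Classical in
/-- The colours that must not be drawn by node `v` in trial `r`. -/
def conflictColours (v : V) (r : Fin M) (ρ : V → Fin M → Fin (p + 1)) : Finset (Fin (p + 1)) :=
  Finset.univ.filter fun y => ∃ u ∈ peelPeers G ident L M D p ρ v,
    peelCurrent G ident L M D p ρ (L + r) u = y

lemma card_conflictColours_le [Finite V] (hid : Function.Injective ident)
    (hlev : ∀ ρ v, (peelRun G ident L M D p ρ L v).level < L) (v : V) (r : Fin M)
    (ρ : V → Fin M → Fin (p + 1)) : (conflictColours G ident L M D p v r ρ).card ≤ D := by
  have h1 := ncard_peelPeers_le G ident L M D p ρ hid (hlev ρ) v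
  have h2 := Set.ncard_image_le (f := peelCurrent G ident L M D p ρ (L + r))
    (Set.toFinite (peelPeers G ident L M D p ρ v))
  have h3 : ((conflictColours G ident L M D p v r ρ).image Fin.val : Set ℕ) ⊆
      peelCurrent G ident L M D p ρ (L + r) '' peelPeers G ident L M D p ρ v := by
    intro c hc
    simp only [conflictColours, Finset.coe_image, Set.mem_image, Finset.mem_coe,
      Finset.mem_filter, Finset.mem_univ, true_and] at hc
    obtain ⟨y, ⟨u, hu, huy⟩, rfl⟩ := hc
    exact ⟨u, hu, huy⟩
  have h4 := Set.ncard_le_ncard h3 (Set.toFinite _)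
  rw [Set.ncard_coe_finset, Finset.card_image_of_injective _ Fin.val_injective] at h4
  lia

/-- Peers are other nodes, so their draws are unchanged, and their states before trial `s ≤ r`
cannot depend on the draw of `v` in trial `r`. This is the independence that
`card_all_trials_bad_le` needs. -/
lemma conflictColours_updateSeed [DecidableEq V] (v : V) {r s : Fin M} (hs : s ≤ r)
    (ρ : V → Fin M → Fin (p + 1)) (y : Fin (p + 1)) :
    conflictColours G ident L M D p v s (updateSeed ρ v r y) =
      conflictColours G ident L M D p v s ρ := by
  have hrun : ∀ τ ≤ L + s, peelRun G ident L M D p (updateSeed ρ v r y) τ =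
      peelRun G ident L M D p ρ τ := by
    intro τ hτ
    refine peelRun_congr _ _ _ _ _ _ (fun u i hi => ?_) hτ
    unfold PeelCore.draw
    split_ifs with h
    · rw [updateSeed_apply_ne]
      right
      intro h1
      rw [← h1] at hs
      have : (s : ℕ) ≤ i - L := hs
      lia
    · rfl
  have hpeers : peelPeers G ident L M D p (updateSeed ρ v r y) v =
      peelPeers G ident L M D p ρ v := by
    simp only [peelPeers, hrun L (by lia)]
  ext c
  simp only [conflictColours, Finset.mem_filter, Finset.mem_univ, true_and, hpeers]
  refine exists_congr fun u => and_congr_right fun hu => ?_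
  have huv : u ≠ v := hu.1.ne'
  have : updateSeed ρ v r y u = ρ u := funext fun i => updateSeed_apply_ne _ _ _ _ (Or.inl huv)
  rw [peelCurrent, peelCurrent, hrun _ le_rfl, this]

/-- A draw that avoids the current colours of all peers is not forbidden, since forbidden colours
are current colours of peers, and it meets no clash; the node would have fixed it. -/
lemma mem_conflictColours (hid : Function.Injective ident)
    (ρ : V → Fin M → Fin (p + 1))
    (hlev : ∀ v, (peelRun G ident L M D p ρ L v).level < L)
    {v : V} (hv : (peelRun G ident L M D p ρ (L + M) v).colour = none) (r : Fin M) :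
    ρ v r ∈ conflictColours G ident L M D p v r ρ := by
  classical
  have h0 := peelRun_colour_eq_none_of_le G ident L M D p ρ (show L + r ≤ L + M by lia) hv
  have h1 := peelRun_colour_eq_none_of_le G ident L M D p ρ (show L + r + 1 ≤ L + M by lia) hv
  have hout := peelRun_out_eq_none_of_colour _ _ _ _ _ _ _ hid hlev h0
  by_contra h
  simp only [conflictColours, Finset.mem_filter, Finset.mem_univ, true_and, not_exists,
    not_and] at h
  have hdraw : PeelCore.draw L (ρ v) (L + r) = ρ v r := by
    simp [PeelCore.draw]
  have hforb : (ρ v r : ℕ) ∉ (peelRun G ident L M D p ρ (L + r) v).forbidden := by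
    intro hf
    obtain ⟨u, hu, hc⟩ := exists_peer_of_mem_forbidden _ _ _ _ _ _ _ hid hlev (by lia) hf
    exact h u hu (peelCurrent_of_colour _ _ _ _ _ _ _ hc)
  have hcur : peelCurrent G ident L M D p ρ (L + r) v = ρ v r := by
    rw [peelCurrent, PeelCore.current, h0, peelRun_clock _ _ _ _ _ _ _ hout, hdraw,
      Option.getD_none, if_neg hforb]
  rw [peelRun_colour_succ' _ _ _ _ _ _ _ hid hlev (by lia) h0, if_pos] at h1
  · simp at h1
  · intro u hu _ hκ
    rw [hcur] at hκ
    exact absurd hκ (h u hu)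

open scoped Classical in
lemma card_uncoloured_le [Fintype V] [DecidableEq V] (hid : Function.Injective ident)
    (hlev : ∀ ρ v, (peelRun G ident L M D p ρ L v).level < L) :
    (Finset.univ.filter fun ρ : V → Fin M → Fin (p + 1) =>
      ∃ v, (peelRun G ident L M D p ρ (L + M) v).colour = none).card * (p + 1) ^ M ≤
      Fintype.card V * (D ^ M * Fintype.card (V → Fin M → Fin (p + 1))) := by
  have hv : ∀ v : V, (Finset.univ.filter fun ρ : V → Fin M → Fin (p + 1) =>
      (peelRun G ident L M D p ρ (L + M) v).colour = none).card * (p + 1) ^ M ≤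
      D ^ M * Fintype.card (V → Fin M → Fin (p + 1)) := by
    intro v
    have h := card_all_trials_bad_le v D (conflictColours G ident L M D p v)
      (card_conflictColours_le G ident L M D p hid hlev v)
      (fun r s ρ y hs => conflictColours_updateSeed G ident L M D p v hs ρ y)
    rw [Fintype.card_fin] at h
    refine le_trans (Nat.mul_le_mul_right _ (Finset.card_le_card ?_)) h
    intro ρ
    simp only [Finset.mem_filter, Finset.mem_univ, true_and]
    exact fun h r => mem_conflictColours G ident L M D p hid ρ (hlev ρ) h r
  have hU : (Finset.univ.filter fun ρ : V → Fin M → Fin (p + 1) =>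
      ∃ v, (peelRun G ident L M D p ρ (L + M) v).colour = none) ⊆
      Finset.univ.biUnion fun v => Finset.univ.filter fun ρ : V → Fin M → Fin (p + 1) =>
        (peelRun G ident L M D p ρ (L + M) v).colour = none := by
    intro ρ
    simp
  calc _ ≤ (∑ v : V, (Finset.univ.filter fun ρ : V → Fin M → Fin (p + 1) =>
        (peelRun G ident L M D p ρ (L + M) v).colour = none).card) * (p + 1) ^ M :=
        Nat.mul_le_mul_right _ ((Finset.card_le_card hU).trans Finset.card_biUnion_le)
    _ = ∑ v : V, (Finset.univ.filter fun ρ : V → Fin M → Fin (p + 1) =>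
        (peelRun G ident L M D p ρ (L + M) v).colour = none).card * (p + 1) ^ M :=
        Finset.sum_mul _ _ _
    _ ≤ ∑ v : V, D ^ M * Fintype.card (V → Fin M → Fin (p + 1)) :=
        Finset.sum_le_sum fun v _ => hv v
    _ = _ := by rw [Finset.sum_const, Finset.card_univ, smul_eq_mul]

/-- The additional round is the one in which a fixed colour is turned into an output. -/
lemma rounds_peelAlgorithm_le (ρ : V → Fin M → Fin (p + 1)) {τ : ℕ} (hτ : L + M ≤ τ)
    (h : ∀ v, (peelRun G ident L M D p ρ τ v).colour ≠ none) :
    (peelAlgorithm L M D p).rounds G ident ρ ≤ ((τ + 1 : ℕ) : ℝ≥0∞) := by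
  refine iInf₂_le (τ + 1) fun v => ?_
  rw [config_peelAlgorithm]
  exact peelRun_out_ne_none G ident L M D p ρ hτ (h v)

lemma producesColoring_peelAlgorithm [Fintype V] (hid : Function.Injective ident)
    (ρ : V → Fin M → Fin (p + 1))
    (hlev : ∀ v, (peelRun G ident L M D p ρ L v).level < L) (hD : D ≤ p) {N : ℕ}
    (hN : L * (p + 1) ≤ N) : (peelAlgorithm L M D p).ProducesColoring G ident ρ N := by
  have hcol : ∀ v, (peelRun G ident L M D p ρ (L + M + 2 * Fintype.card V) v).colour ≠ none :=
    fun v h => peelRun_colour_ne_none G ident L M D p ρ hid hlev hD v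
      (peelRun_colour_eq_none_of_le _ _ _ _ _ _ _ (by lia) h)
  have hout := fun v => peelRun_out_eq _ _ _ _ _ _ _ hid hlev
    (peelRun_out_ne_none G ident L M D p ρ (Nat.le_add_right _ _) (hcol v))
  choose c hc ho using hout
  have hcp := fun v => peelRun_colour_le _ _ _ _ _ _ _ hid hlev hD (hc v)
  refine ⟨L + M + 2 * Fintype.card V + 1, SimpleGraph.Coloring.mk (fun v =>
    ⟨(peelRun G ident L M D p ρ L v).level * (p + 1) + c v, ?_⟩) ?_, fun v => ?_⟩
  · have h1 := hcp v
    have h2 := Nat.mul_le_mul_right (p + 1) (Nat.succ_le_of_lt (hlev v))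
    rw [Nat.succ_eq_add_one, add_mul, one_mul] at h2
    lia
  · intro u v huv h
    rw [Fin.mk.injEq] at h
    -- Division by `p + 1` recovers layer and colour from an output, so equal outputs force adjacent
    -- nodes to be peers with equal colours.
    have h1 : ∀ w, ((peelRun G ident L M D p ρ L w).level * (p + 1) + c w) % (p + 1) = c w := by
      intro w
      rw [Nat.mul_add_mod', Nat.mod_eq_of_lt (Nat.lt_succ_of_le (hcp w))]
    have h3 : c u = c v := by rw [← h1 u, h, h1 v]
    have h4 : (peelRun G ident L M D p ρ L u).level = (peelRun G ident L M D p ρ L v).level := by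
      rw [h3, Nat.add_right_cancel_iff] at h
      exact Nat.eq_of_mul_eq_mul_right (Nat.succ_pos p) h
    exact peelRun_colour_ne G ident L M D p ρ hid hlev hD _
      (show u ∈ peelPeers G ident L M D p ρ v from ⟨huv.symm, h4⟩) (hc u) (h3 ▸ hc v)
  · rw [config_peelAlgorithm]
    exact ho v

/-- Here `ε` bounds the failure of one node, `|V| ε` that of any node, and a failure costs at most
`2|V|` more rounds. -/
theorem peelAlgorithm_colors [Fintype V] [DecidableEq V] (hid : Function.Injective ident)
    (hlev : ∀ ρ v, (peelRun G ident L M D p ρ L v).level < L) (hD : D ≤ p) {N : ℕ}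
    (hN : L * (p + 1) ≤ N) {T δ ε : ℝ} (hε : ((D : ℝ) / (p + 1)) ^ M ≤ ε)
    (hT : L + M + 1 + 2 * Fintype.card V * (Fintype.card V * ε) ≤ T)
    (hδ : Fintype.card V * ε ≤ δ) :
    (peelAlgorithm L M D p).Colors G ident N T δ := by
  classical
  refine ⟨fun ρ => producesColoring_peelAlgorithm G ident L M D p hid ρ (hlev ρ) hD hN, ?_⟩
  refine LocalAlgorithm.rounds_bounds G ident _
    (Finset.univ.filter fun ρ : V → Fin M → Fin (p + 1) =>
      ∃ v, (peelRun G ident L M D p ρ (L + M) v).colour = none)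
    (L + M + 1) (2 * Fintype.card V) (ε := Fintype.card V * ε) ?_ ?_ ?_ ?_ hδ
  · intro ρ hρ
    refine rounds_peelAlgorithm_le G ident L M D p ρ le_rfl fun v hv => hρ ?_
    exact Finset.mem_filter.2 ⟨Finset.mem_univ _, v, hv⟩
  · intro ρ
    have := rounds_peelAlgorithm_le G ident L M D p ρ
      (Nat.le_add_right (L + M) (2 * Fintype.card V)) fun v h =>
        peelRun_colour_ne_none G ident L M D p ρ hid (hlev ρ) hD v
          (peelRun_colour_eq_none_of_le _ _ _ _ _ _ _ (by lia) h)
    rwa [show L + M + 1 + 2 * Fintype.card V = L + M + 2 * Fintype.card V + 1 by ring]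
  · have h := card_uncoloured_le G ident L M D p hid hlev
    change _ ≤ _ * ((Fintype.card (V → Fin M → Fin (p + 1)) : ℕ) : ℝ)
    generalize Fintype.card (V → Fin M → Fin (p + 1)) = Ω at h ⊢
    have hp : (0 : ℝ) < ((p : ℝ) + 1) ^ M := by positivity
    have h' : ((Finset.univ.filter fun ρ : V → Fin M → Fin (p + 1) =>
      ∃ v, (peelRun G ident L M D p ρ (L + M) v).colour = none).card : ℝ) * ((p : ℝ) + 1) ^ M ≤
        Fintype.card V * ((D : ℝ) ^ M * Ω) := by exact_mod_cast h
    rw [← le_div_iff₀ hp] at h'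
    refine h'.trans ?_
    rw [div_pow] at hε
    calc (Fintype.card V * ((D : ℝ) ^ M * Ω)) / ((p : ℝ) + 1) ^ M
        = Fintype.card V * ((D : ℝ) ^ M / ((p : ℝ) + 1) ^ M) * Ω := by ring
      _ ≤ _ := by gcongr
  · push_cast
    linarith

end Analysis

end

/-! ### Choice of the parameters -/

lemma sqrt_pow_eq_rpow {t : ℝ} (ht : 0 ≤ t) (k : ℕ) : √t ^ k = t ^ ((k : ℝ) / 2) := by
  rw [Real.sqrt_eq_rpow, ← Real.rpow_natCast, ← Real.rpow_mul ht]
  ring_nf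

/-- The threshold is placed at `√t`, between `1` and `t` on the scale `2ca`, so that a peeling round
and a random trial both gain a factor `√t`; `2 log_t n` such factors make up `n`. -/
lemma peelAlgorithm_colors_of_arboricity {c : ℝ} (hc : 1 ≤ c) (d : ℕ) {n : ℕ} (hn : 2 ≤ n)
    {G : SimpleGraph (Fin n)} (hG : G ≠ ⊥) {ident : Fin n → ℕ}
    (hid : Function.Injective ident) {a : ℝ} (ha : a ≤ c * G.arboricity)
    (ha' : (G.arboricity : ℝ) ≤ c * a) {t : ℝ} (ht : 2 < t) {N T : ℝ}
    (hN : 9 * c ^ 2 * (t * G.arboricity * Real.logb 2 n) ≤ N)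
    (hT : (2 * d + 6) * Real.logb t n + 5 ≤ T) :
    (peelAlgorithm (⌊2 * Real.logb t n⌋₊ + 1) ⌈2 * (d + 2) * Real.logb t n⌉₊
      ⌊2 * c * a * √t⌋₊ ⌊2 * c * a * t⌋₊).Colors G ident ⌊N⌋₊ T (1 / (n : ℝ) ^ d) := by
  have hα : (1 : ℝ) ≤ G.arboricity := by exact_mod_cast SimpleGraph.one_le_arboricity hG
  have hca : 0 < c * a := by linarith
  have hn' : (2 : ℝ) ≤ n := by exact_mod_cast hn
  have hst : √t ≤ t := Real.sqrt_le_iff.2 ⟨by linarith, by nlinarith⟩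
  have hs : 0 < √t := Real.sqrt_pos.2 (by linarith)
  have hss : √t * √t = t := Real.mul_self_sqrt (by linarith)
  have hℓ : 0 < Real.logb t n := Real.logb_pos (by linarith) (by linarith)
  have hlog : 1 ≤ Real.logb 2 n := by
    rw [Real.le_logb_iff_rpow_le (by norm_num) (by linarith)]
    simpa using hn'
  have hlog_le : Real.logb t n ≤ Real.logb 2 n := by
    rw [Real.logb, Real.logb]
    exact div_le_div_of_nonneg_left (Real.log_nonneg (by linarith)) (Real.log_pos (by norm_num))
      (Real.log_le_log (by norm_num) ht.le)
  have htℓ : t ^ Real.logb t n = n :=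
    Real.rpow_logb (by linarith) (by linarith) (by linarith)
  have hp := Nat.floor_le (show 0 ≤ 2 * c * a * t by nlinarith)
  have hp' := Nat.lt_floor_add_one (2 * c * a * t)
  have hD := Nat.floor_le (show 0 ≤ 2 * c * a * √t by nlinarith)
  have hD' := Nat.lt_floor_add_one (2 * c * a * √t)
  have hL := Nat.floor_le (show 0 ≤ 2 * Real.logb t n by linarith)
  have hL' := Nat.lt_floor_add_one (2 * Real.logb t n)
  have hM := Nat.le_ceil (2 * (d + 2) * Real.logb t n)
  have hM' := Nat.ceil_lt_add_one (show 0 ≤ 2 * (d + 2) * Real.logb t n by positivity)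
  set p := ⌊2 * c * a * t⌋₊
  set D := ⌊2 * c * a * √t⌋₊
  set L := ⌊2 * Real.logb t n⌋₊
  set M := ⌈2 * (d + 2) * Real.logb t n⌉₊
  have hnd : (0 : ℝ) < (n : ℝ) ^ d := by positivity
  -- In the exponent `d + 2`, one factor `n` pays for the union bound and another for the length of
  -- the greedy phase.
  refine peelAlgorithm_colors G ident (L + 1) M D p hid (fun ρ v => ?_)
    (Nat.floor_le_floor (by nlinarith)) (Nat.le_floor (le_trans ?_ hN))
    (ε := 1 / (n : ℝ) ^ (d + 2)) ?_ ?_ ?_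
  · refine peelRun_level_lt G ident (L + 1) M D p ρ hid hs.le (fun S T hTS h => ?_) ?_ v
    · have h1 : T.card * (D + 1) ≤ 2 * G.arboricity * S.card :=
        calc T.card * (D + 1) ≤ ∑ v ∈ T, {u | G.Adj v u ∧ u ∈ S}.ncard := by
              simpa using Finset.card_nsmul_le_sum T _ (D + 1) h
          _ ≤ ∑ v ∈ S, {u | G.Adj v u ∧ u ∈ S}.ncard :=
              Finset.sum_le_sum_of_subset hTS
          _ ≤ _ := G.sum_card_adj_le S
      have h2 : (T.card : ℝ) * (D + 1) ≤ 2 * G.arboricity * S.card := by exact_mod_cast h1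
      have h3 : (T.card : ℝ) * (2 * c * a * √t) ≤ T.card * (D + 1) := by gcongr
      have h4 : 2 * (G.arboricity : ℝ) * S.card ≤ 2 * (c * a) * S.card := by gcongr
      have h5 : (2 * (c * a)) * (T.card * √t) ≤ (2 * (c * a)) * S.card := by linarith
      exact le_of_mul_le_mul_left h5 (by linarith)
    · rw [Fintype.card_fin, sqrt_pow_eq_rpow (by linarith)]
      nth_rewrite 1 [← htℓ]
      refine Real.rpow_lt_rpow_of_exponent_lt (by linarith) ?_
      push_cast
      linarith
  · push_cast
    have h1 : (L : ℝ) + 1 ≤ 3 * Real.logb 2 n := by linarith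
    have h2 : 2 * (c * a) * t ≤ 2 * (c * (c * G.arboricity)) * t := by gcongr
    have h3 : 1 ≤ c * (c * G.arboricity) * t := by
      have h4 : 1 ≤ c * (c * G.arboricity) := by nlinarith [one_le_mul_of_one_le_of_one_le hc hα]
      nlinarith
    have h5 : (p : ℝ) + 1 ≤ 3 * (c * (c * G.arboricity) * t) := by linarith
    calc ((L : ℝ) + 1) * (p + 1)
        ≤ (3 * Real.logb 2 n) * (3 * (c * (c * G.arboricity) * t)) := by gcongr
      _ = _ := by ring
  · have h1 : (D : ℝ) / (p + 1) ≤ 1 / √t := by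
      rw [div_le_div_iff₀ (by positivity) hs]
      have h2 : (D : ℝ) * √t ≤ (2 * c * a * √t) * √t := by gcongr
      nlinarith
    refine (pow_le_pow_left₀ (by positivity) h1 M).trans ?_
    rw [one_div_pow]
    refine one_div_le_one_div_of_le (by positivity) ?_
    rw [sqrt_pow_eq_rpow (by linarith)]
    nth_rewrite 1 [← htℓ]
    rw [← Real.rpow_natCast, ← Real.rpow_mul (by linarith)]
    refine Real.rpow_le_rpow_of_exponent_le (by linarith) ?_
    push_cast
    linarith
  · rw [Fintype.card_fin]
    have h1 : 2 * (n : ℝ) * (n * (1 / (n : ℝ) ^ (d + 2))) = 2 * (1 / (n : ℝ) ^ d) := by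
      field_simp
      ring
    have h2 : 1 / (n : ℝ) ^ d ≤ 1 := by
      rw [div_le_one hnd]
      exact one_le_pow₀ (by linarith)
    rw [h1]
    push_cast
    linarith
  · rw [Fintype.card_fin]
    have h1 : (n : ℝ) * (1 / (n : ℝ) ^ (d + 2)) = 1 / (n : ℝ) ^ (d + 1) := by
      field_simp
      ring
    rw [h1]
    exact one_div_le_one_div_of_le hnd (pow_le_pow_right₀ (by linarith) (Nat.le_succ d))

theorem mainTheorem10 (K c D : ℝ) (hc : 1 ≤ c) (q d : ℕ) :
    ∃ (C : ℝ) (A : ℕ → ℝ → ℝ → LocalAlgorithm), 0 < C ∧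
      ∀ n : ℕ, 2 ≤ n →
      ∀ G : SimpleGraph (Fin n), G ≠ ⊥ →
      ∀ ident : Fin n → ℕ, Function.Injective ident → (∀ v, ident v < n ^ q) →
      ∀ a : ℝ, a ≤ c * G.arboricity → (G.arboricity : ℝ) ≤ c * a →
        -- the tradeoff with parameter `t`
        (∀ t : ℝ, 2 < t → t ≤ K * √((n : ℝ) / Real.logb 2 n) →
          (A n a t).Colors G ident
            ⌊C * (t * G.arboricity * Real.logb 2 n)⌋₊
            (C * (Real.logb t n + logStar n))
            (1 / (n : ℝ) ^ d)) ∧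
        -- the choice `t = n ^ (1 / k)`
        (∀ k : ℝ, 0 < k → 2 < (n : ℝ) ^ (1 / k) →
          (n : ℝ) ^ (1 / k) ≤ K * √((n : ℝ) / Real.logb 2 n) →
          (A n a ((n : ℝ) ^ (1 / k))).Colors G ident
            ⌊C * (G.arboricity * (n : ℝ) ^ (1 / k) * Real.logb 2 n)⌋₊
            (C * (k + logStar n))
            (1 / (n : ℝ) ^ d) ∧
          ((logStar n : ℝ) ≤ D * k →
            (A n a ((n : ℝ) ^ (1 / k))).Colors G ident
              ⌊C * (G.arboricity * (n : ℝ) ^ (1 / k) * Real.logb 2 n)⌋₊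
              (C * k)
              (1 / (n : ℝ) ^ d))) := by
  -- The first summand serves the number of colours, the second the rounds, where `1 + |D|` allows
  -- `log* n` to be replaced by `|D| k`.
  set C : ℝ := 9 * c ^ 2 + (2 * d + 6) * (1 + |D|) with hC
  have hC1 : 9 * c ^ 2 ≤ C := by
    have : 0 ≤ (2 * (d : ℝ) + 6) * (1 + |D|) := by positivity
    linarith
  have hC2 : (2 * (d : ℝ) + 6) * (1 + |D|) ≤ C := by
    have : 0 ≤ 9 * c ^ 2 := by positivity
    linarith
  have hd : (0 : ℝ) ≤ d := Nat.cast_nonneg d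
  have hC3 : 2 * (d : ℝ) + 6 ≤ C := by
    have : 0 ≤ (2 * (d : ℝ) + 6) * |D| := by positivity
    linarith
  have hC0 : 0 < C := by linarith
  refine ⟨C, fun n a t => peelAlgorithm (⌊2 * Real.logb t n⌋₊ + 1)
    ⌈2 * (d + 2) * Real.logb t n⌉₊ ⌊2 * c * a * √t⌋₊ ⌊2 * c * a * t⌋₊, hC0, ?_⟩
  intro n hn G hG ident hid _ a ha ha'
  have hn' : (2 : ℝ) ≤ n := by exact_mod_cast hn
  have hlog : 0 < Real.logb 2 n := Real.logb_pos (by norm_num) (by linarith)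
  have hstar : (1 : ℝ) ≤ logStar n := by exact_mod_cast one_le_logStar hn
  have colours : ∀ t : ℝ, 2 < t → 9 * c ^ 2 * (t * G.arboricity * Real.logb 2 n) ≤
      C * (t * G.arboricity * Real.logb 2 n) := by
    intro t ht
    have : 0 < t := by linarith
    gcongr
  -- Since `log* n ≥ 1`, the term `(2d + 6) log* n` absorbs the constant `5`.
  have rounds : ∀ x : ℝ, 0 ≤ x → (2 * d + 6) * x + 5 ≤ (2 * d + 6) * (x + logStar n) := by
    intro x hx
    nlinarith
  refine ⟨fun t ht _ => ?_, fun k hk ht _ => ?_⟩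
  · have hℓ : 0 < Real.logb t n := Real.logb_pos (by linarith) (by linarith)
    refine peelAlgorithm_colors_of_arboricity hc d hn hG hid ha ha' ht (colours t ht) ?_
    refine (rounds _ hℓ.le).trans ?_
    gcongr
  · have hk' : Real.logb ((n : ℝ) ^ (1 / k)) n = k := by
      rw [Real.logb, Real.log_rpow (by linarith)]
      have : 0 < Real.log n := Real.log_pos (by linarith)
      field_simp
    have hcol := colours _ ht
    rw [mul_comm (G.arboricity : ℝ) ((n : ℝ) ^ (1 / k))]
    refine ⟨?_, fun hD => ?_⟩
    · refine peelAlgorithm_colors_of_arboricity hc d hn hG hid ha ha' ht hcol ?_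
      rw [hk']
      refine (rounds k hk.le).trans ?_
      gcongr
    · refine peelAlgorithm_colors_of_arboricity hc d hn hG hid ha ha' ht hcol ?_
      rw [hk']
      have h1 : (logStar n : ℝ) ≤ |D| * k :=
        hD.trans (mul_le_mul_of_nonneg_right (le_abs_self D) hk.le)
      calc (2 * d + 6) * k + 5 ≤ (2 * d + 6) * (k + logStar n) := rounds k hk.le
        _ ≤ (2 * d + 6) * (k + |D| * k) := by gcongr
        _ = (2 * d + 6) * (1 + |D|) * k := by ring
        _ ≤ C * k := by gcongr
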